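/- Let $n\ge 1$. The crown poset $\mathcal{C}_{2n}$ is the poset on $[2n]=\{1,\dots,2n\}$ with cover relations $1\prec 2\succ 3\prec\cdots\succ 2n-1\prec 2n\succ 1$ (for $n=1$ this is the chain $1\prec 2$). Its order polytope is $$\mathcal{O}(\mathcal{C}_{2n})=\{x\in[0,1]^{2n} : x_i\le x_j \text{ whenever } i\preceq j \text{ in } \mathcal{C}_{2n}\}.$$ For a lattice polytope $\mathfrak{p}\subseteq\mathbb{R}^m$ of dimension $d$, the $h^*$-polynomial $h^*(\mathfrak{p},t)$ is the polynomial of degree at most $d$ determined by $$1+\sum_{k\ge 1}\#(k\mathfrak{p}\cap\mathbb{Z}^m)\,t^k=\frac{h^*(\mathfrak{p},t)}{(1-t)^{d+1}}.$$ Let $\operatorname{CA}_{2n}$ be the set of cyclically alternating permutations of $[2n]$, that is, permutations $\sigma=\sigma_1\sigma_2\cdots\sigma_{2n}$ with $\sigma_1<\sigma_2>\sigma_3<\cdots>\sigma_{2n-1}<\sigma_{2n}>\sigma_1$. For $\sigma\in\operatorname{CA}_{2n}$ let $\operatorname{cswap}(\sigma)$ be the number of $i\in\{1,\dots,2n-1\}$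 with $\sigma^{-1}(i)>\sigma^{-1}(i+1)+1$. Then $$h^*(\mathcal{O}(\mathcal{C}_{2n}),t)=\sum_{\sigma\in\operatorname{CA}_{2n}}t^{\operatorname{cswap}(\sigma)}.$$ -/

import Mathlib

open scoped Pointwise

/-! ### Lattice polytopes and the `h^*`-polynomial -/

/-- The affine dimension of a set `K ⊆ ℝ^ι`. -/
noncomputable def affDim {ι : Type*} (K : Set (ι → ℝ)) : ℕ :=
  Module.finrank ℝ (vectorSpan ℝ K)

/-- The number `#(k K ∩ ℤ^ι)` of integer points in the `k`-th dilate of `K`. -/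
noncomputable def latticePointCount {ι : Type*} (K : Set (ι → ℝ)) (k : ℕ) : ℕ :=
  Set.ncard {z : ι → ℤ | (fun i => (z i : ℝ)) ∈ (k : ℝ) • K}

/-- The Ehrhart series `1 + ∑_{k ≥ 1} #(k K ∩ ℤ^ι) t^k`. -/
noncomputable def ehrhartSeries {ι : Type*} (K : Set (ι → ℝ)) : PowerSeries ℤ :=
  PowerSeries.mk fun k => if k = 0 then 1 else (latticePointCount K k : ℤ)

/-- `h` is the `h^*`-polynomial of `K`: with `d = dim K`, it has degree at most `d` and
`1 + ∑_{k ≥ 1} #(k K ∩ ℤ^ι) t^k = h(t) / (1 - t)^(d + 1)`. -/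
def IsHStarPolynomial {ι : Type*} (K : Set (ι → ℝ)) (h : Polynomial ℤ) : Prop :=
  h.natDegree ≤ affDim K ∧
    ehrhartSeries K * (1 - PowerSeries.X) ^ (affDim K + 1) = (h : PowerSeries ℤ)

/-- A set has at most one `h^*`-polynomial. -/
theorem IsHStarPolynomial.unique {ι : Type*} {K : Set (ι → ℝ)} {h h' : Polynomial ℤ}
    (H : IsHStarPolynomial K h) (H' : IsHStarPolynomial K h') : h = h' :=
  Polynomial.coe_injective ℤ (H.2.symm.trans H'.2)

/-! ### Order polytopes -/

/-- The order polytope of a poset `P`, as a subset of `ℝ^P`. -/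
def orderPolytope (P : Type*) [PartialOrder P] : Set (P → ℝ) :=
  {x | (∀ p, 0 ≤ x p ∧ x p ≤ 1) ∧ ∀ p q, p ≤ q → x p ≤ x q}

/-! ### The crown poset -/

/-- The ground set of the crown poset; the element of value `i` stands for the label `i + 1`. -/
def Crown (n : ℕ) : Type := Fin (2 * n)

instance Crown.instFintype (n : ℕ) : Fintype (Crown n) := inferInstanceAs (Fintype (Fin (2 * n)))

instance Crown.instDecidableEq (n : ℕ) : DecidableEq (Crown n) :=
  inferInstanceAs (DecidableEq (Fin (2 * n)))

/-- The underlying number in `{0, …, 2n - 1}`. -/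
def Crown.val {n : ℕ} (a : Crown n) : ℕ := Fin.val (show Fin (2 * n) from a)

theorem Crown.val_injective {n : ℕ} : Function.Injective (Crown.val (n := n)) :=
  fun _ _ h => Fin.ext h

/-- The cover relations `1 ≺ 2 ≻ 3 ≺ ⋯ ≻ 2n - 1 ≺ 2n ≻ 1`: in terms of the values (labels minus
one), the element `2j + 1` covers `2j` and `2j + 2`, the latter taken modulo `2n`. -/
def Crown.Cover {n : ℕ} (a b : Crown n) : Prop :=
  ∃ j : ℕ, b.val = 2 * j + 1 ∧ (a.val = 2 * j ∨ a.val = (2 * j + 2) % (2 * n))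

theorem Crown.Cover.even_odd {n : ℕ} {a b : Crown n} (h : Crown.Cover a b) :
    a.val % 2 = 0 ∧ b.val % 2 = 1 := by
  obtain ⟨j, hb, ha | ha⟩ := h
  · omega
  · refine ⟨?_, by omega⟩
    rw [ha, Nat.mod_mul_right_mod]
    omega

/-- The crown poset. No two cover relations can be composed, so that its order is the reflexive
closure of the cover relations. -/
instance Crown.instPartialOrder (n : ℕ) : PartialOrder (Crown n) where
  le a b := a = b ∨ Crown.Cover a b
  le_refl _ := Or.inl rfl
  le_trans a b c := by
    rintro (rfl | hab) (rfl | hbc)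
    · exact Or.inl rfl
    · exact Or.inr hbc
    · exact Or.inr hab
    · have h1 := hab.even_odd
      have h2 := hbc.even_odd
      omega
  le_antisymm a b := by
    rintro (rfl | hab) (h | hba)
    · rfl
    · rfl
    · exact h.symm
    · have h1 := hab.even_odd
      have h2 := hba.even_odd
      omega

theorem Crown.le_iff {n : ℕ} {a b : Crown n} : a ≤ b ↔ a = b ∨ Crown.Cover a b := Iff.rfl

/-- The cover relations of the crown poset are the prescribed ones. -/
theorem Crown.covBy_iff {n : ℕ} {a b : Crown n} : a ⋖ b ↔ Crown.Cover a b := by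
  have key : ∀ {x y : Crown n}, x < y ↔ Crown.Cover x y := by
    intro x y
    rw [lt_iff_le_and_ne, Crown.le_iff]
    constructor
    · rintro ⟨rfl | h, hne⟩
      · exact absurd rfl hne
      · exact h
    · intro h
      refine ⟨Or.inr h, ?_⟩
      rintro rfl
      have := h.even_odd
      omega
  constructor
  · intro h
    exact key.1 h.1
  · intro h
    refine ⟨key.2 h, fun c hac hcb => ?_⟩
    have h1 := (key.1 hac).even_odd
    have h2 := (key.1 hcb).even_odd
    omega

/-! ### Cyclically alternating permutations

A permutation `σ` of `[2n]` is given on `Fin (2n)`, positions and values being shifted by one: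
`σ i` is `σ_{i+1} - 1`. -/

/-- `σ_1 < σ_2 > σ_3 < ⋯ > σ_{2n-1} < σ_{2n} > σ_1`. -/
def IsCyclicallyAlternating {n : ℕ} (σ : Equiv.Perm (Fin (2 * n))) : Prop :=
  ∀ j : Fin n,
    σ ⟨2 * j.val, by omega⟩ < σ ⟨2 * j.val + 1, by omega⟩ ∧
    σ ⟨(2 * j.val + 2) % (2 * n), Nat.mod_lt _ (Nat.mul_pos Nat.two_pos j.pos)⟩ < σ ⟨2 * j.val + 1, by omega⟩

instance IsCyclicallyAlternating.instDecidable {n : ℕ} (σ : Equiv.Perm (Fin (2 * n))) :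
    Decidable (IsCyclicallyAlternating σ) :=
  inferInstanceAs (Decidable (∀ _ : Fin n, _ ∧ _))

/-- The set of cyclically alternating permutations of `[2n]`. -/
def cyclicallyAlternatingPerms (n : ℕ) : Finset (Equiv.Perm (Fin (2 * n))) :=
  Finset.univ.filter fun σ => IsCyclicallyAlternating σ

/-- The number of `i < 2n` in `[2n]` with `σ⁻¹(i) > σ⁻¹(i + 1) + 1`. -/
def cswap {n : ℕ} (σ : Equiv.Perm (Fin (2 * n))) : ℕ :=
  (Finset.univ.filter fun i : Fin (2 * n) =>
    ∃ h : i.val + 1 < 2 * n, (σ.symm ⟨i.val + 1, h⟩).val + 1 < (σ.symm i).val).card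

/-! This is Stanley's P-partition argument. For k ≥ 1 the lattice points of the k-th dilate are the
order-preserving maps f from the crown to {0, …, k}. Sorting the positions by f, with ties broken by
the natural labelling `crownKey`, gives a linear extension of the crown, that is, a cyclically
alternating σ. The maps with a given σ are the weakly increasing sequences that rise strictly at the
descents of the labelling along σ⁻¹ (`card_crownMaps`). Such sequences have generating function t^d
/ (1 - t)^(2n + 1), with d the number of descents (`mk_card_gapChains_mul_one_sub_pow`). For this
labelling the descents are exactly the cyclic swaps (`swapGap_eq`). Since the polytope has dimension
2n, summing over σ gives the theorem. -/

/-! ### Chains with prescribed gaps -/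

/-- The sequences `g_0, …, g_{m-1}` in `{0, …, k}` with `g_i + e_i ≤ g_{i+1}`. -/
noncomputable def gapChains (m : ℕ) (e : ℕ → ℕ) (k : ℕ) : Finset (Fin m → ℕ) :=
  open Classical in
  (Fintype.piFinset fun _ => Finset.range (k + 1)).filter fun g =>
    ∀ (i : ℕ) (h : i + 1 < m), g ⟨i, by omega⟩ + e i ≤ g ⟨i + 1, h⟩

theorem mem_gapChains {m : ℕ} {e : ℕ → ℕ} {k : ℕ} {g : Fin m → ℕ} :
    g ∈ gapChains m e k ↔ (∀ i, g i ≤ k) ∧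
      ∀ (i : ℕ) (h : i + 1 < m), g ⟨i, by omega⟩ + e i ≤ g ⟨i + 1, h⟩ := by
  simp [gapChains]

theorem monotone_of_step_le {m : ℕ} {α : Type*} [Preorder α] {g : Fin m → α}
    (hg : ∀ (i : ℕ) (h : i + 1 < m), g ⟨i, by omega⟩ ≤ g ⟨i + 1, h⟩) : Monotone g := by
  cases m with
  | zero => exact fun a => a.elim0
  | succ m => exact Fin.monotone_iff_le_succ.2 fun i => hg i.val (by omega)

theorem monotone_of_mem_gapChains {m : ℕ} {e : ℕ → ℕ} {k : ℕ} {g : Fin m → ℕ}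
    (hg : g ∈ gapChains m e k) : Monotone g :=
  monotone_of_step_le fun i h => (Nat.le_add_right _ _).trans ((mem_gapChains.1 hg).2 i h)

theorem card_gapChains_one (e : ℕ → ℕ) (k : ℕ) : (gapChains 1 e k).card = k + 1 := by
  have : gapChains 1 e k = Fintype.piFinset fun _ => Finset.range (k + 1) := by
    classical
    exact Finset.filter_true_of_mem fun g _ i h => absurd h (by omega)
  rw [this, Fintype.card_piFinset]
  simp

/-- The chains whose last entry is the bound `k`. -/
theorem card_gapChains_last_eq (m : ℕ) (e : ℕ → ℕ) (k : ℕ) :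
    ((gapChains (m + 2) e k).filter fun g => g (Fin.last (m + 1)) = k).card =
      if e m ≤ k then (gapChains (m + 1) e (k - e m)).card else 0 := by
  split_ifs with hk
  · refine Finset.card_bij' (fun g _ => fun i : Fin (m + 1) => g i.castSucc)
      (fun g _ => Fin.snoc (α := fun _ => ℕ) g k) ?_ ?_ ?_ ?_
    · intro g hg
      obtain ⟨hg, hl⟩ := Finset.mem_filter.1 hg
      have hmono := monotone_of_mem_gapChains hg
      have hg := mem_gapChains.1 hg
      refine mem_gapChains.2 ⟨fun i => ?_, fun i h => hg.2 i (by omega)⟩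
      have h1 : g i.castSucc ≤ g ⟨m, by omega⟩ :=
        hmono (Fin.le_def.2 (Nat.lt_succ_iff.1 i.isLt))
      have h2 := hg.2 m (by omega)
      have h3 : g ⟨m + 1, by omega⟩ = k := hl
      omega
    · intro g hg
      have hg := mem_gapChains.1 hg
      refine Finset.mem_filter.2 ⟨mem_gapChains.2 ⟨fun i => ?_, fun i h => ?_⟩, by simp⟩
      · induction i using Fin.lastCases with
        | last => simp
        | cast i => simpa using (hg.1 i).trans (Nat.sub_le _ _)
      · have hc : (⟨i, by omega⟩ : Fin (m + 2)) = Fin.castSucc ⟨i, by omega⟩ := rfl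
        rw [hc, Fin.snoc_castSucc (α := fun _ => ℕ)]
        rcases Nat.lt_or_ge (i + 1) (m + 1) with h' | h'
        · have hd : (⟨i + 1, h⟩ : Fin (m + 2)) = Fin.castSucc ⟨i + 1, h'⟩ := rfl
          rw [hd, Fin.snoc_castSucc (α := fun _ => ℕ)]
          exact hg.2 i h'
        · obtain rfl : i = m := by omega
          have hd : (⟨i + 1, h⟩ : Fin (i + 2)) = Fin.last (i + 1) := rfl
          rw [hd, Fin.snoc_last (α := fun _ => ℕ)]
          have := hg.1 ⟨i, by omega⟩
          omega
    · intro g hg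
      obtain ⟨-, hl⟩ := Finset.mem_filter.1 hg
      funext i
      induction i using Fin.lastCases with
      | last => simp [hl]
      | cast i => simp
    · intro g _
      funext i
      simp
  · refine Finset.card_eq_zero.2 (Finset.filter_eq_empty_iff.2 fun g hg hl => hk ?_)
    have h2 := (mem_gapChains.1 hg).2 m (by omega)
    have h3 : g ⟨m + 1, by omega⟩ = k := hl
    omega

theorem card_gapChains_succ (m : ℕ) (e : ℕ → ℕ) (k : ℕ) :
    (gapChains (m + 1) e (k + 1)).card = (gapChains (m + 1) e k).card +
      ((gapChains (m + 1) e (k + 1)).filter fun g => g (Fin.last m) = k + 1).card := by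
  rw [← Finset.card_filter_add_card_filter_not (s := gapChains (m + 1) e (k + 1))
    (fun g => g (Fin.last m) = k + 1), add_comm]
  congr 2
  ext g
  rw [Finset.mem_filter]
  constructor
  · rintro ⟨hg, hl⟩
    refine mem_gapChains.2 ⟨fun i => ?_, (mem_gapChains.1 hg).2⟩
    have h1 := monotone_of_mem_gapChains hg (Fin.le_last i)
    have h2 := (mem_gapChains.1 hg).1 (Fin.last m)
    omega
  · intro hg
    have hg' := mem_gapChains.1 hg
    refine ⟨mem_gapChains.2 ⟨fun i => (hg'.1 i).trans (Nat.le_succ k), hg'.2⟩, ?_⟩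
    have := hg'.1 (Fin.last m)
    omega

theorem gapChains_zero_filter_last (m : ℕ) (e : ℕ → ℕ) :
    ((gapChains (m + 1) e 0).filter fun g => g (Fin.last m) = 0) = gapChains (m + 1) e 0 :=
  Finset.filter_true_of_mem fun _ hg => Nat.le_zero.1 ((mem_gapChains.1 hg).1 _)

/-- Multiplying by 1 - X takes differences in k, which leaves the chains whose last entry is exactly
k. Deleting that entry gives a shorter chain bounded by `k - e m`, whence the factor `X ^ e m`. -/
theorem mk_card_gapChains_mul_one_sub (m : ℕ) (e : ℕ → ℕ) :
    (PowerSeries.mk fun k => ((gapChains (m + 2) e k).card : ℤ)) * (1 - PowerSeries.X) =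
      PowerSeries.X ^ e m * PowerSeries.mk fun k => ((gapChains (m + 1) e k).card : ℤ) := by
  have key (k : ℕ) : PowerSeries.coeff k (PowerSeries.X ^ e m *
      PowerSeries.mk fun k => ((gapChains (m + 1) e k).card : ℤ)) =
      (((gapChains (m + 2) e k).filter fun g => g (Fin.last (m + 1)) = k).card : ℤ) := by
    rw [card_gapChains_last_eq, PowerSeries.coeff_X_pow_mul']
    split_ifs <;> simp
  ext k
  rw [key, mul_sub, mul_one, map_sub]
  cases k with
  | zero => rw [gapChains_zero_filter_last]; simp
  | succ k =>
    rw [PowerSeries.coeff_succ_mul_X, PowerSeries.coeff_mk, PowerSeries.coeff_mk,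
      card_gapChains_succ]
    push_cast
    ring

theorem mk_card_gapChains_mul_one_sub_pow (m : ℕ) (e : ℕ → ℕ) :
    (PowerSeries.mk fun k => ((gapChains (m + 1) e k).card : ℤ)) * (1 - PowerSeries.X) ^ (m + 2) =
      PowerSeries.X ^ ∑ i ∈ Finset.range m, e i := by
  induction m with
  | zero =>
    have := PowerSeries.mk_add_choose_mul_one_sub_pow_eq_one (S := ℤ) 1
    simp only [Nat.choose_one_right] at this
    simpa [card_gapChains_one, add_comm] using this
  | succ m ih =>
    rw [pow_succ' _ (m + 2), ← mul_assoc, mk_card_gapChains_mul_one_sub, mul_assoc, ih, ← pow_add,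
      Finset.sum_range_succ, add_comm]

/-! ### A natural labelling of the crown poset -/

/-- A labelling that lists the positions `0, …, 2n - 1` as `0, 2, 1, 4, 3, …`. -/
def crownKey (v : ℕ) : ℕ := if v % 2 = 0 then 2 * v else 2 * v + 3

theorem crownKey_injective : Function.Injective crownKey := by
  intro a b h
  unfold crownKey at h
  split_ifs at h <;> omega

/-- The offset 3 puts an odd v just after v + 1, hence after both elements it covers; in the
wrap-around cover, reduction modulo 2n only lowers the smaller key. -/
theorem crownKey_lt_of_cover {n : ℕ} {a b : Crown n} (h : Crown.Cover a b) :
    crownKey a.val < crownKey b.val := by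
  have hp := h.even_odd
  obtain ⟨j, hb, ha⟩ := h
  have : a.val ≤ 2 * j + 2 := by
    rcases ha with ha | ha
    · omega
    · exact ha ▸ Nat.mod_le _ _
  unfold crownKey
  split_ifs <;> omega

theorem isCyclicallyAlternating_iff {n : ℕ} (σ : Equiv.Perm (Fin (2 * n))) :
    IsCyclicallyAlternating σ ↔ ∀ a b : Fin (2 * n), Crown.Cover (n := n) a b → σ a < σ b := by
  constructor
  · rintro h a b ⟨j, hb, ha⟩
    have hb : b.val = 2 * j + 1 := hb
    have hj : j < n := by omega
    rw [show b = ⟨2 * j + 1, by omega⟩ from Fin.ext hb]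
    rcases ha with ha | ha
    · rw [show a = ⟨2 * j, by omega⟩ from Fin.ext ha]
      exact (h ⟨j, hj⟩).1
    · rw [show a = ⟨(2 * j + 2) % (2 * n), Nat.mod_lt _ (by omega)⟩ from Fin.ext ha]
      exact (h ⟨j, hj⟩).2
  · intro h j
    exact ⟨h _ _ ⟨j, rfl, Or.inl rfl⟩, h _ _ ⟨j, rfl, Or.inr rfl⟩⟩

/-- `1` where the permutation has a cyclic swap, and `0` elsewhere. -/
def swapGap {n : ℕ} (σ : Equiv.Perm (Fin (2 * n))) (i : ℕ) : ℕ :=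
  if ∃ h : i + 1 < 2 * n, (σ.symm ⟨i + 1, h⟩).val + 1 < (σ.symm ⟨i, by omega⟩).val then 1 else 0

theorem cswap_eq_sum_swapGap {m n : ℕ} (hm : m + 1 = 2 * n) (σ : Equiv.Perm (Fin (2 * n))) :
    cswap σ = ∑ i ∈ Finset.range m, swapGap σ i := by
  -- The top index 2n - 1 has no successor, so it adds nothing.
  have hlast : swapGap σ m = 0 := if_neg fun ⟨h, _⟩ => by omega
  rw [← add_zero (∑ i ∈ Finset.range m, swapGap σ i), ← hlast, ← Finset.sum_range_succ, hm,
    ← Fin.sum_univ_eq_sum_range, cswap, Finset.card_filter]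
  rfl

/-- In a linear extension, cyclic swaps are the descents of the natural labelling. -/
theorem swapGap_eq {n : ℕ} {σ : Equiv.Perm (Fin (2 * n))} (hσ : IsCyclicallyAlternating σ)
    {i : ℕ} (h : i + 1 < 2 * n) :
    swapGap σ i = if crownKey (σ.symm ⟨i, by omega⟩).val < crownKey (σ.symm ⟨i + 1, h⟩).val
      then 0 else 1 := by
  rw [isCyclicallyAlternating_iff] at hσ
  obtain ⟨a, ha⟩ : ∃ a, a = σ.symm ⟨i, by omega⟩ := ⟨_, rfl⟩
  obtain ⟨b, hb⟩ : ∃ b, b = σ.symm ⟨i + 1, h⟩ := ⟨_, rfl⟩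
  have hab : ¬ σ b < σ a := by
    rw [ha, hb, Equiv.apply_symm_apply, Equiv.apply_symm_apply]
    exact fun h => by simp [Fin.lt_def] at h
  have hne : a.val ≠ b.val := by
    intro he
    have := σ.symm.injective (ha.symm.trans ((Fin.ext he).trans hb))
    simp at this
  -- The key comparison differs from b + 1 < a only when b is even and a = b ± 1. Then a covers b,
  -- so σ b < σ a, although σ a = i and σ b = i + 1.
  have h1 : ¬ (b.val % 2 = 0 ∧ a.val = b.val + 1) := fun ⟨h0, h1⟩ =>
    hab (hσ b a ⟨b.val / 2, show a.val = _ by omega, Or.inl (show b.val = _ by omega)⟩)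
  have h2 : ¬ (b.val % 2 = 0 ∧ b.val = a.val + 1) := fun ⟨h0, h1⟩ =>
    hab (hσ b a ⟨a.val / 2, show a.val = _ by omega, Or.inr (show b.val = _ by
      rw [Nat.mod_eq_of_lt] <;> omega)⟩)
  have hiff : (∃ h : i + 1 < 2 * n, (σ.symm ⟨i + 1, h⟩).val + 1 < (σ.symm ⟨i, by omega⟩).val) ↔
      ¬ crownKey a.val < crownKey b.val := by
    rw [exists_prop_of_true h, ← ha, ← hb]
    unfold crownKey
    split_ifs <;> omega
  rw [swapGap, if_congr hiff rfl rfl, ← ha, ← hb, ite_not]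

/-! ### Order-preserving maps -/

/-- The order-preserving maps from the crown poset to `{0, …, k}`. -/
noncomputable def crownMaps (n k : ℕ) : Finset (Fin (2 * n) → ℕ) :=
  open Classical in
  (Fintype.piFinset fun _ => Finset.range (k + 1)).filter fun f =>
    ∀ a b : Fin (2 * n), Crown.Cover (n := n) a b → f a ≤ f b

theorem mem_crownMaps {n k : ℕ} {f : Fin (2 * n) → ℕ} :
    f ∈ crownMaps n k ↔ (∀ i, f i ≤ k) ∧
      ∀ a b : Fin (2 * n), Crown.Cover (n := n) a b → f a ≤ f b := by
  simp [crownMaps]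

/-- The values of `f`, with ties broken by the natural labelling. -/
def crownLex {n : ℕ} (f : Fin (2 * n) → ℕ) (a : Fin (2 * n)) : ℕ ×ₗ ℕ :=
  toLex (f a, crownKey a.val)

theorem crownLex_injective {n : ℕ} (f : Fin (2 * n) → ℕ) : Function.Injective (crownLex f) :=
  fun _ _ h => Fin.ext (crownKey_injective (Prod.ext_iff.1 (toLex.injective h)).2)

theorem crownLex_le_iff {n : ℕ} {f : Fin (2 * n) → ℕ} {a b : Fin (2 * n)} :
    crownLex f a ≤ crownLex f b ↔ f a < f b ∨ f a = f b ∧ crownKey a.val ≤ crownKey b.val :=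
  Prod.Lex.toLex_le_toLex

/-- The permutation that ranks the positions by `crownLex f`. -/
def crownRank {n : ℕ} (f : Fin (2 * n) → ℕ) : Equiv.Perm (Fin (2 * n)) :=
  (Tuple.sort (crownLex f)).symm

theorem monotone_crownLex_crownRank {n : ℕ} (f : Fin (2 * n) → ℕ) :
    Monotone (crownLex f ∘ (crownRank f).symm) :=
  Tuple.monotone_sort (crownLex f)

/-- The tie-broken values are distinct, so only one permutation sorts them. -/
theorem eq_crownRank_of_monotone {n : ℕ} {f : Fin (2 * n) → ℕ} {σ : Equiv.Perm (Fin (2 * n))}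
    (h : Monotone (crownLex f ∘ σ.symm)) : σ = crownRank f := by
  have : σ.symm = Tuple.sort (crownLex f) := Tuple.eq_sort_iff.2 ⟨h, fun i j hij he =>
    absurd (σ.symm.injective (crownLex_injective f he)) hij.ne⟩
  rw [crownRank, ← this, Equiv.symm_symm]

theorem isCyclicallyAlternating_crownRank {n k : ℕ} {f : Fin (2 * n) → ℕ}
    (hf : f ∈ crownMaps n k) : IsCyclicallyAlternating (crownRank f) := by
  rw [isCyclicallyAlternating_iff]
  intro a b hab
  by_contra! hle
  have h := monotone_crownLex_crownRank f hle
  simp only [Function.comp_apply, Equiv.symm_apply_apply] at h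
  have h1 := (mem_crownMaps.1 hf).2 a b hab
  have h2 : crownKey a.val < crownKey b.val := crownKey_lt_of_cover hab
  rcases crownLex_le_iff.1 h with h | h <;> omega

theorem comp_crownRank_symm_mem_gapChains {n k : ℕ} {f : Fin (2 * n) → ℕ}
    (hf : f ∈ crownMaps n k) :
    f ∘ (crownRank f).symm ∈ gapChains (2 * n) (swapGap (crownRank f)) k := by
  refine mem_gapChains.2 ⟨fun i => (mem_crownMaps.1 hf).1 _, fun i h => ?_⟩
  rw [swapGap_eq (isCyclicallyAlternating_crownRank hf) h]
  have hle : (⟨i, by omega⟩ : Fin (2 * n)) ≤ ⟨i + 1, h⟩ := Nat.le_succ i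
  have hne : crownKey ((crownRank f).symm ⟨i, by omega⟩).val ≠
      crownKey ((crownRank f).symm ⟨i + 1, h⟩).val := by
    intro he
    have := (crownRank f).symm.injective (Fin.ext (crownKey_injective he))
    simp at this
  -- At a descent of the keys, equal values would contradict the tie-break, so f rises by at least
  -- 1.
  have := crownLex_le_iff.1 (monotone_crownLex_crownRank f hle)
  simp only [Function.comp_apply]
  split_ifs <;> omega

theorem comp_mem_crownMaps {n k : ℕ} {σ : Equiv.Perm (Fin (2 * n))}
    (hσ : IsCyclicallyAlternating σ) {g : Fin (2 * n) → ℕ}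
    (hg : g ∈ gapChains (2 * n) (swapGap σ) k) : g ∘ σ ∈ crownMaps n k :=
  mem_crownMaps.2 ⟨fun _ => (mem_gapChains.1 hg).1 _, fun a b hab =>
    monotone_of_mem_gapChains hg ((isCyclicallyAlternating_iff σ).1 hσ a b hab).le⟩

theorem crownRank_comp {n k : ℕ} {σ : Equiv.Perm (Fin (2 * n))}
    (hσ : IsCyclicallyAlternating σ) {g : Fin (2 * n) → ℕ}
    (hg : g ∈ gapChains (2 * n) (swapGap σ) k) : crownRank (g ∘ σ) = σ := by
  refine (eq_crownRank_of_monotone (monotone_of_step_le fun i h => ?_)).symm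
  have := (mem_gapChains.1 hg).2 i h
  rw [swapGap_eq hσ h] at this
  simp only [Function.comp_apply, crownLex_le_iff, Equiv.apply_symm_apply]
  split_ifs at this <;> omega

theorem card_crownMaps (n k : ℕ) :
    (crownMaps n k).card =
      ∑ σ ∈ cyclicallyAlternatingPerms n, (gapChains (2 * n) (swapGap σ) k).card := by
  rw [← Finset.card_sigma]
  refine Finset.card_bij' (fun f _ => ⟨crownRank f, f ∘ (crownRank f).symm⟩)
    (fun p _ => p.2 ∘ p.1) ?_ ?_ ?_ ?_
  · intro f hf
    exact Finset.mem_sigma.2 ⟨Finset.mem_filter.2 ⟨Finset.mem_univ _,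
      isCyclicallyAlternating_crownRank hf⟩, comp_crownRank_symm_mem_gapChains hf⟩
  · rintro ⟨σ, g⟩ hp
    obtain ⟨hσ, hg⟩ := Finset.mem_sigma.1 hp
    exact comp_mem_crownMaps (Finset.mem_filter.1 hσ).2 hg
  · intro f _
    funext a
    simp
  · rintro ⟨σ, g⟩ hp
    obtain ⟨hσ, hg⟩ := Finset.mem_sigma.1 hp
    have h := crownRank_comp (Finset.mem_filter.1 hσ).2 hg
    simp only at h ⊢
    rw [h]
    congr 1
    funext a
    simp

/-! ### Lattice points and dimension of the order polytope -/

theorem mem_smul_orderPolytope_iff {P : Type*} [PartialOrder P] {k : ℕ} (hk : k ≠ 0)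
    {x : P → ℝ} : x ∈ (k : ℝ) • orderPolytope P ↔
      (∀ p, 0 ≤ x p ∧ x p ≤ k) ∧ ∀ p q, p ≤ q → x p ≤ x q := by
  have hk' : (0 : ℝ) < k := by positivity
  rw [Set.mem_smul_set_iff_inv_smul_mem₀ hk'.ne']
  simp only [orderPolytope, Set.mem_ofPred_eq, Pi.smul_apply, smul_eq_mul]
  refine and_congr (forall_congr' fun p => and_congr ?_ ?_) (forall₃_congr fun p q _ => ?_)
  · exact mul_nonneg_iff_of_pos_left (inv_pos.2 hk')
  · rw [inv_mul_le_iff₀ hk', mul_one]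
  · exact mul_le_mul_iff_right₀ (inv_pos.2 hk')

theorem latticePointCount_orderPolytope_crown (n : ℕ) {k : ℕ} (hk : k ≠ 0) :
    latticePointCount (orderPolytope (Crown n)) k = (crownMaps n k).card := by
  have himage : {z : Crown n → ℤ | (fun i => (z i : ℝ)) ∈ (k : ℝ) • orderPolytope (Crown n)} =
      (fun (f : Fin (2 * n) → ℕ) (a : Crown n) => (f a : ℤ)) '' (crownMaps n k : Set _) := by
    ext z
    simp only [Set.mem_ofPred_eq, mem_smul_orderPolytope_iff hk, Set.mem_image, Finset.mem_coe]
    constructor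
    · rintro ⟨h1, h2⟩
      have h0 (a) : 0 ≤ z a := by exact_mod_cast (h1 a).1
      refine ⟨fun a => (z a).toNat, mem_crownMaps.2 ⟨fun a => ?_, fun a b hab => ?_⟩, ?_⟩
      · have : z a ≤ k := by exact_mod_cast (h1 a).2
        exact Int.toNat_le.2 this
      · have : z a ≤ z b := by exact_mod_cast h2 a b (Or.inr hab)
        exact Int.toNat_le_toNat this
      · funext a
        exact Int.toNat_of_nonneg (h0 a)
    · rintro ⟨f, hf, rfl⟩
      have hf := mem_crownMaps.1 hf
      refine ⟨fun a => ⟨by simp, ?_⟩, fun a b hab => ?_⟩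
      · have := hf.1 a
        simpa using this
      · rcases hab with rfl | hab
        · exact le_rfl
        · simpa using hf.2 a b hab
  rw [latticePointCount, himage, Set.ncard_image_of_injective, Set.ncard_coe_finset]
  intro f f' h
  funext a
  exact Int.ofNat.inj (congrFun h a)

theorem card_crownMaps_zero (n : ℕ) : (crownMaps n 0).card = 1 := by
  refine Finset.card_eq_one.2 ⟨0, ?_⟩
  ext f
  rw [mem_crownMaps, Finset.mem_singleton]
  constructor
  · exact fun h => funext fun i => Nat.le_zero.1 (h.1 i)
  · rintro rfl
    simp

theorem ehrhartSeries_orderPolytope_crown (n : ℕ) :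
    ehrhartSeries (orderPolytope (Crown n)) =
      PowerSeries.mk fun k => ((crownMaps n k).card : ℤ) := by
  ext k
  rw [ehrhartSeries, PowerSeries.coeff_mk, PowerSeries.coeff_mk]
  split_ifs with hk
  · rw [hk, card_crownMaps_zero, Nat.cast_one]
  · rw [latticePointCount_orderPolytope_crown n hk]

theorem vectorSpan_orderPolytope_crown (n : ℕ) :
    vectorSpan ℝ (orderPolytope (Crown n)) = ⊤ := by
  -- With 1/3 on minimal and 2/3 on maximal elements, any one coordinate can be raised by up to 1/3
  -- inside the polytope, so every coordinate direction lies in the span.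
  obtain ⟨x, hx⟩ : ∃ x : Crown n → ℝ, ∀ a, x a = if a.val % 2 = 0 then 1 / 3 else 2 / 3 :=
    ⟨_, fun _ => rfl⟩
  have hmem (s : ℝ) (hs : 0 ≤ s) (hs' : s ≤ 1 / 3) (p : Crown n) :
      x + Pi.single p s ∈ orderPolytope (Crown n) := by
    have hsingle (a : Crown n) : 0 ≤ (Pi.single p s : Crown n → ℝ) a ∧
        (Pi.single p s : Crown n → ℝ) a ≤ 1 / 3 := by
      rw [Pi.single_apply]
      split_ifs <;> constructor <;> linarith
    refine ⟨fun a => ?_, fun a b hab => ?_⟩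
    · have := hsingle a
      rw [Pi.add_apply, hx]
      split_ifs <;> constructor <;> linarith
    · rcases hab with rfl | hab
      · exact le_rfl
      · have hpar := hab.even_odd
        have ha := hsingle a
        have hb := hsingle b
        rw [Pi.add_apply, Pi.add_apply, hx, hx, if_pos hpar.1, if_neg (by omega)]
        linarith
  have hsingle (p : Crown n) (c : ℝ) :
      (Pi.single p c : Crown n → ℝ) ∈ vectorSpan ℝ (orderPolytope (Crown n)) := by
    have h := vsub_mem_vectorSpan ℝ (hmem (1 / 3) (by norm_num) le_rfl p)
      (hmem 0 le_rfl (by norm_num) p)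
    rw [Pi.single_zero, add_zero, vsub_eq_sub, add_sub_cancel_left] at h
    have h' := Submodule.smul_mem _ (3 * c) h
    rwa [← Pi.single_smul, smul_eq_mul, show 3 * c * (1 / 3) = c by ring] at h'
  refine (Submodule.eq_top_iff').2 fun y => ?_
  rw [← Finset.univ_sum_single y]
  exact Submodule.sum_mem _ fun p _ => hsingle p _

theorem affDim_orderPolytope_crown (n : ℕ) : affDim (orderPolytope (Crown n)) = 2 * n := by
  rw [affDim, vectorSpan_orderPolytope_crown, finrank_top, Module.finrank_fintype_fun_eq_card]
  exact Fintype.card_fin (2 * n)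

theorem cswap_le {n : ℕ} (σ : Equiv.Perm (Fin (2 * n))) : cswap σ ≤ 2 * n :=
  (Finset.card_le_univ _).trans (Fintype.card_fin _).le

theorem mainTheorem1 (n : ℕ) (hn : 1 ≤ n) :
    IsHStarPolynomial (orderPolytope (Crown n))
      (∑ σ ∈ cyclicallyAlternatingPerms n, (Polynomial.X : Polynomial ℤ) ^ cswap σ) := by
  rw [IsHStarPolynomial, affDim_orderPolytope_crown]
  constructor
  · exact Polynomial.natDegree_sum_le_of_forall_le _ _ fun σ _ =>
      (Polynomial.natDegree_X_pow_le _).trans (cswap_le σ)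
  · obtain ⟨m, hm⟩ : ∃ m, m + 1 = 2 * n := ⟨2 * n - 1, by omega⟩
    have hsum : ehrhartSeries (orderPolytope (Crown n)) =
        ∑ σ ∈ cyclicallyAlternatingPerms n,
          PowerSeries.mk fun k => ((gapChains (2 * n) (swapGap σ) k).card : ℤ) := by
      rw [ehrhartSeries_orderPolytope_crown]
      ext k
      simp [card_crownMaps]
    rw [hsum, Finset.sum_mul, ← Polynomial.coeToPowerSeries.ringHom_apply, map_sum]
    refine Finset.sum_congr rfl fun σ _ => ?_
    rw [cswap_eq_sum_swapGap hm, ← hm, mk_card_gapChains_mul_one_sub_pow]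
    simp
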